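/- All graphs are finite, simple and undirected. A graph $G$ is $F$-subgraph-free if no (not necessarily induced) subgraph of $G$ is isomorphic to $F$; it has diameter at most $d$ if any two of its vertices are joined by a path with at most $d$ edges. An elimination forest of $G$ is a rooted forest $T$ with $V(T)=V(G)$ such that for every edge $uv$ of $G$ one of $u,v$ is an ancestor of the other in $T$; the treedepth of $G$ is the minimum height of an elimination forest of $G$, where the height is the maximum number of vertices on a root-to-leaf path. A class of graphs has bounded treedepth if there is a constant $c$ such that every graph in the class has treedepth at most $c$. A linear forest is a disjoint union of paths (a single vertex is a path), and a graph $F$ is an apex linear forest if $F-v$ is a linear forest for some vertex $v$ of $F$. \textbf{Theorem.} For every tree $F$, the class of $F$-subgraph-free graphs of diameter at most $3$ has bounded treedepth if and only if $F$ is an acyclic apex linear forest. -/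

import Mathlib

universe u v

/-- A rooted forest with vertex set `V`: every vertex has at most one parent (the roots are the
vertices without a parent), and repeatedly passing to the parent always reaches a root. -/
structure RootedForest (V : Type u) where
  parent : V → Option V
  wellFounded : WellFounded (fun a b : V => parent b = some a)

namespace RootedForest

variable {V : Type u}

/-- `T.IsAncestor a b`: the vertex `a` lies on the path from the root to `b` in `T`
(every vertex is an ancestor of itself). -/
def IsAncestor (T : RootedForest V) : V → V → Prop :=
  Relation.ReflTransGen (fun a b => T.parent b = some a)

/-- The number of vertices on the path from the root to `b`. -/
noncomputable def depth (T : RootedForest V) (b : V) : ℕ∞ :=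
  {a | T.IsAncestor a b}.encard

/-- The height: the largest number of vertices on a path from a root to another vertex. -/
noncomputable def height (T : RootedForest V) : ℕ∞ :=
  ⨆ b, T.depth b

end RootedForest

namespace SimpleGraph

/-- `T` is an elimination forest of `G`: the ends of every edge of `G` lie on a common
root-to-leaf path of `T`, that is, one of them is an ancestor of the other. -/
def IsEliminationForest {V : Type u} (G : SimpleGraph V) (T : RootedForest V) : Prop :=
  ∀ a b : V, G.Adj a b → T.IsAncestor a b ∨ T.IsAncestor b a

/-- The treedepth: the minimum height of an elimination forest. -/
noncomputable def treedepth {V : Type u} (G : SimpleGraph V) : ℕ∞ :=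
  ⨅ (T : RootedForest V) (_ : G.IsEliminationForest T), T.height

/-- A linear forest is a disjoint union of (finite) paths. -/
def IsLinearForest {V : Type u} (G : SimpleGraph V) : Prop :=
  ∀ C : G.ConnectedComponent, ∃ n : ℕ, Nonempty (C.toSimpleGraph ≃g pathGraph n)

/-- An apex linear forest: deleting some vertex leaves a linear forest. -/
def IsApexLinearForest {V : Type u} (G : SimpleGraph V) : Prop :=
  ∃ x : V, (G.induce {x}ᶜ).IsLinearForest

/-- A class of finite graphs has bounded treedepth if some constant bounds the treedepth of all
its members. -/
def HasBoundedTreedepth (C : ∀ W : Type v, SimpleGraph W → Prop) : Prop :=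
  ∃ c : ℕ, ∀ (W : Type v) [Finite W] (G : SimpleGraph W), C W G → G.treedepth ≤ c

end SimpleGraph

/-! Fans, that is, paths with one further vertex joined to everything, have diameter at most 2, and
all their subgraphs are apex linear forests. If `F` is not one, fans are `F`-free, and their long
paths force large treedepth (`lt_treedepth_of_path`). For the converse, `treedepth_le_of_no_path`
reduces the task to bounding the length of paths. Let `x` be an apex of `F` and `K` the order of
`F`. By acyclicity `x` has at most one neighbour in each component of `F - x`, so `K` disjoint
double arms that avoid `v` and have midpoints adjacent to `v` would give a copy of `F`. Choosing
arms greedily then shows `HasSpoilers`: few vertices meet all double arms centred at neighbours of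
`v`. Nothing else about `F` is used. Call a vertex poor if it is not `Rich`. Two arms that meet only
in their start form a double arm, so every vertex has few rich neighbours. Cut a long path into
blocks. Two block cores are joined by a walk with at most three edges, leaving through one or two
outside vertices; after thinning the family these are not all rich. This yields many disjoint double
arms with poor midpoints (`exists_not_rich_family`). Let `u`, `u'` be two such midpoints, and `X`,
`X'` small sets that meet all their arms. After thinning, a walk of length at most three between
them must be `u, a, a', u'` with `a ∈ X` and `a' ∈ X'`. Both for rich and for poor vertices the
number of such links is bounded, so some pair has none, a contradiction (`card_lt_of_not_rich`). -/

/-! ### Thinning and counting in finite families -/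

/-- A relation with bounded out-degrees on a large finite set has a large independent set. -/
theorem Finset.exists_independent_of_outdegree_le {ι : Type*} (r : ι → ι → Prop)
    (d n : ℕ) (I : Finset ι) (hd : ∀ i ∈ I, ∀ T ⊆ I, (∀ j ∈ T, r i j) → T.card ≤ d)
    (hI : (2 * d + 1) * n ≤ I.card) :
    ∃ J ⊆ I, J.card = n ∧ ∀ i ∈ J, ∀ j ∈ J, i ≠ j → ¬ r i j := by
  classical
  induction n generalizing I with
  | zero => exact ⟨∅, by simp, by simp, by simp⟩
  | succ n ih =>
    have hne : I.Nonempty := by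
      rw [← Finset.card_pos]
      exact lt_of_lt_of_le (by positivity) hI
    have hd' : ∀ i ∈ I, (I.filter fun j => r i j).card ≤ d := fun i hi =>
      hd i hi _ (Finset.filter_subset _ _) fun j hj => (Finset.mem_filter.1 hj).2
    -- In-degrees and out-degrees have the same sum, so some in-degree is at most `d`. Deleting `j`
    -- with its in- and out-neighbours costs at most `2 * d + 1` elements.
    obtain ⟨j, hj, hjd⟩ : ∃ j ∈ I, (I.filter fun i => r i j).card ≤ d := by
      by_contra! hcon
      have h1 : ∑ j ∈ I, (I.filter fun i => r i j).card =
          ∑ i ∈ I, (I.filter fun j => r i j).card := by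
        simp only [Finset.card_filter]
        exact Finset.sum_comm
      have h2 := Finset.sum_le_sum hd'
      have h3 := Finset.sum_lt_sum_of_nonempty hne hcon
      omega
    set D := insert j ((I.filter fun i => r i j) ∪ (I.filter fun i => r j i)) with hD
    have hDc : D.card ≤ 2 * d + 1 := by
      have h1 := Finset.card_insert_le j ((I.filter fun i => r i j) ∪ (I.filter fun i => r j i))
      have h2 := Finset.card_union_le (I.filter fun i => r i j) (I.filter fun i => r j i)
      have h3 := hd' j hj
      rw [hD]
      omega
    obtain ⟨J, hJ, hJc, hJi⟩ := ih (I \ D)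
      (fun i hi T hT => hd i (Finset.mem_sdiff.1 hi).1 T (hT.trans Finset.sdiff_subset))
      (by have := Finset.le_card_sdiff D I; rw [mul_add] at hI; omega)
    have hout : ∀ i ∈ J, i ∈ I ∧ i ≠ j ∧ ¬ r i j ∧ ¬ r j i := by
      intro i hi
      have := hJ hi
      simp only [hD, Finset.mem_sdiff, Finset.mem_insert, Finset.mem_union, Finset.mem_filter] at this
      tauto
    refine ⟨insert j J, ?_, ?_, ?_⟩
    · intro i hi
      rcases Finset.mem_insert.1 hi with rfl | hi
      · exact hj
      · exact (hout i hi).1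
    · rw [Finset.card_insert_of_notMem fun h => (hout j h).2.1 rfl, hJc]
    · intro a ha b hb hab
      rcases Finset.mem_insert.1 ha with ha' | ha' <;> rcases Finset.mem_insert.1 hb with hb' | hb'
      · exact absurd (ha'.trans hb'.symm) hab
      · exact ha' ▸ (hout b hb').2.2.2
      · exact hb' ▸ (hout a ha').2.2.1
      · exact hJi a ha' b hb' hab

/-- A finite set meets at most as many members of a disjoint family as it has elements. -/
theorem Finset.card_le_of_forall_not_disjoint {ι α : Type*}
    (I : Finset ι) (A : ι → Finset α) (X : Finset α)
    (hA : ∀ i ∈ I, ∀ j ∈ I, i ≠ j → Disjoint (A i) (A j)) (hX : ∀ i ∈ I, ¬ Disjoint (A i) X) :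
    I.card ≤ X.card := by
  have h : ∀ i : I, ∃ x, x ∈ A i ∧ x ∈ X := fun i => Finset.not_disjoint_iff.1 (hX i i.2)
  choose f hf using h
  rw [← Finset.card_attach]
  refine Finset.card_le_card_of_injOn f (fun i _ => (hf i).2) ?_
  intro i _ j _ hij
  by_contra hne
  refine Finset.disjoint_left.1 (hA i i.2 j j.2 fun h => hne (Subtype.ext h)) (hf i).1 ?_
  rw [hij]
  exact (hf j).1

/-- Bounding the number of indices related to some element of a finite set. -/
theorem Finset.card_le_mul_of_forall_exists {ι α : Type*} (I : Finset ι) (X : Finset α)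
    (p : α → ι → Prop) (m d : ℕ) (hX : X.card ≤ m)
    (h : ∀ x ∈ X, ∀ T ⊆ I, (∀ i ∈ T, p x i) → T.card ≤ d) (hI : ∀ i ∈ I, ∃ x ∈ X, p x i) :
    I.card ≤ m * d := by
  classical
  refine le_trans ?_ (Nat.mul_le_mul_right d hX)
  refine (Finset.card_le_card (t := X.biUnion fun x => I.filter (p x)) ?_).trans
    (Finset.card_biUnion_le_card_mul _ _ _ fun x hx =>
      h x hx _ (Finset.filter_subset _ _) fun i hi => (Finset.mem_filter.1 hi).2)
  intro i hi
  obtain ⟨x, hx, hp⟩ := hI i hi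
  exact Finset.mem_biUnion.2 ⟨x, hx, Finset.mem_filter.2 ⟨hi, hp⟩⟩

/-! ### Arms and double arms -/

namespace SimpleGraph

variable {W : Type v} {G : SimpleGraph W}

/-- `G.Arm K z A`: the set `A` contains a path with `K` edges that starts at `z`. -/
def Arm (G : SimpleGraph W) (K : ℕ) (z : W) (A : Finset W) : Prop :=
  ∃ f : ℕ → W, f 0 = z ∧ (∀ i ≤ K, ∀ j ≤ K, f i = f j → i = j) ∧
    (∀ i < K, G.Adj (f i) (f (i + 1))) ∧ ∀ i ≤ K, f i ∈ A

/-- `G.DoubleArm K z A`: the set `A` contains a path with `2 * K` edges and midpoint `z`. -/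
def DoubleArm (G : SimpleGraph W) (K : ℕ) (z : W) (A : Finset W) : Prop :=
  ∃ A₁ ⊆ A, ∃ A₂ ⊆ A, G.Arm K z A₁ ∧ G.Arm K z A₂ ∧ ∀ x ∈ A₁, x ∈ A₂ → x = z

/-- Every vertex of `A` is the start of a path with `K` edges inside `A`. -/
def Armed (G : SimpleGraph W) (K : ℕ) (A : Finset W) : Prop :=
  ∀ z ∈ A, G.Arm K z A

theorem Arm.mono {K : ℕ} {z : W} {A A' : Finset W} (h : G.Arm K z A) (hA : A ⊆ A') :
    G.Arm K z A' := by
  obtain ⟨f, h0, hi, ha, hm⟩ := h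
  exact ⟨f, h0, hi, ha, fun i hK => hA (hm i hK)⟩

theorem Arm.mem {K : ℕ} {z : W} {A : Finset W} (h : G.Arm K z A) : z ∈ A := by
  obtain ⟨f, h0, hi, ha, hm⟩ := h
  exact h0 ▸ hm 0 (Nat.zero_le _)

theorem Arm.exists_card_le [DecidableEq W] {K : ℕ} {z : W} {A : Finset W} (h : G.Arm K z A) :
    ∃ A' ⊆ A, A'.card ≤ K + 1 ∧ G.Arm K z A' := by
  obtain ⟨f, h0, hi, ha, hm⟩ := h
  refine ⟨(Finset.range (K + 1)).image f, ?_, ?_, f, h0, hi, ha, ?_⟩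
  · intro x hx
    obtain ⟨i, hi, rfl⟩ := Finset.mem_image.1 hx
    exact hm i (Nat.lt_succ_iff.1 (Finset.mem_range.1 hi))
  · exact Finset.card_image_le.trans (by simp)
  · intro i hi
    exact Finset.mem_image_of_mem _ (Finset.mem_range.2 (by omega))

theorem Arm.cons [DecidableEq W] {K : ℕ} {w z : W} {A : Finset W} (h : G.Arm K z A)
    (hw : w ∉ A) (hwz : G.Adj w z) : G.Arm K w (insert w A) := by
  obtain ⟨f, h0, hi, ha, hm⟩ := h
  refine ⟨fun n => Nat.casesOn n w f, rfl, ?_, ?_, ?_⟩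
  · rintro (_ | i) hi' (_ | j) hj' hij
    · rfl
    · exact absurd ((show w = f j from hij) ▸ hm j (by omega)) hw
    · exact absurd ((show f i = w from hij) ▸ hm i (by omega)) hw
    · rw [hi i (by omega) j (by omega) hij]
  · rintro (_ | i) hi'
    · simpa [h0] using hwz
    · exact ha i (by omega)
  · rintro (_ | i) hi'
    · simp
    · exact Finset.mem_insert_of_mem (hm i (by omega))

theorem DoubleArm.mono {K : ℕ} {z : W} {A A' : Finset W} (h : G.DoubleArm K z A) (hA : A ⊆ A') :
    G.DoubleArm K z A' := by
  obtain ⟨A₁, h1, A₂, h2, h⟩ := h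
  exact ⟨A₁, h1.trans hA, A₂, h2.trans hA, h⟩

theorem DoubleArm.exists_card_le [DecidableEq W] {K : ℕ} {z : W} {A : Finset W}
    (h : G.DoubleArm K z A) : ∃ A' ⊆ A, A'.card ≤ 2 * K + 2 ∧ G.DoubleArm K z A' := by
  obtain ⟨A₁, h1, A₂, h2, a1, a2, h⟩ := h
  obtain ⟨A₁', s1, c1, a1'⟩ := a1.exists_card_le
  obtain ⟨A₂', s2, c2, a2'⟩ := a2.exists_card_le
  refine ⟨A₁' ∪ A₂', Finset.union_subset (s1.trans h1) (s2.trans h2), ?_, A₁',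
    Finset.subset_union_left, A₂', Finset.subset_union_right, a1', a2',
    fun x hx hx' => h x (s1 hx) (s2 hx')⟩
  have := Finset.card_union_le A₁' A₂'
  omega

/-- Armed sets are convenient because a walk that ends in one can be absorbed vertex by vertex,
without asking whether it meets the set earlier. -/
theorem Armed.insert [DecidableEq W] {K : ℕ} {A : Finset W} (hA : G.Armed K A) {w z : W}
    (hz : z ∈ A) (hwz : G.Adj w z) : G.Armed K (insert w A) := by
  intro x hx
  by_cases hxA : x ∈ A
  · exact (hA x hxA).mono (Finset.subset_insert _ _)
  · obtain rfl : x = w := (Finset.mem_insert.1 hx).resolve_right hxA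
    exact (hA z hz).cons hxA hwz

theorem Armed.union [DecidableEq W] {K : ℕ} {A A' : Finset W} (hA : G.Armed K A)
    (hA' : G.Armed K A') : G.Armed K (A ∪ A') := by
  intro x hx
  rcases Finset.mem_union.1 hx with hx | hx
  · exact (hA x hx).mono Finset.subset_union_left
  · exact (hA' x hx).mono Finset.subset_union_right

/-- A double arm as a sequence indexed by the integers between `-K` and `K`. -/
theorem DoubleArm.exists_int {K : ℕ} {z : W} {A : Finset W} (h : G.DoubleArm K z A) :
    ∃ q : ℤ → W, q 0 = z ∧ (∀ i j : ℤ, |i| ≤ K → |j| ≤ K → q i = q j → i = j) ∧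
      (∀ i : ℤ, |i| ≤ K → |i + 1| ≤ K → G.Adj (q i) (q (i + 1))) ∧
      ∀ i : ℤ, |i| ≤ K → q i ∈ A := by
  obtain ⟨A₁, h1, A₂, h2, ⟨f, f0, fi, fa, fm⟩, ⟨g, g0, gi, ga, gm⟩, h⟩ := h
  have key : ∀ i j : ℕ, i ≤ K → j ≤ K → f i = g j → i = 0 ∧ j = 0 := by
    intro i j hi hj hij
    have hz : f i = z := h _ (fm i hi) (hij ▸ gm j hj)
    exact ⟨fi i hi 0 (by omega) (hz.trans f0.symm), gi j hj 0 (by omega) ((hij ▸ hz).trans g0.symm)⟩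
  refine ⟨fun i => if 0 ≤ i then f i.toNat else g (-i).toNat, by simpa using f0, ?_, ?_, ?_⟩
  · intro i j hi hj hij
    rw [abs_le] at hi hj
    simp only at hij
    split_ifs at hij with h1 h2 h2
    · have := fi _ (by omega) _ (by omega) hij
      omega
    · have := key _ _ (by omega) (by omega) hij
      omega
    · have := key _ _ (by omega) (by omega) hij.symm
      omega
    · have := gi _ (by omega) _ (by omega) hij
      omega
  · intro i hi hj
    rw [abs_le] at hi hj
    simp only
    split_ifs with h1 h2 h2
    · have := fa i.toNat (by omega)
      rwa [show i.toNat + 1 = (i + 1).toNat by omega] at this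
    · omega
    · obtain rfl : i = -1 := by omega
      have := ga 0 (by omega)
      rw [g0, ← f0] at this
      simpa using this.symm
    · have := ga (-(i + 1)).toNat (by omega)
      rw [show (-(i + 1)).toNat + 1 = (-i).toNat by omega] at this
      exact this.symm
  · intro i hi
    rw [abs_le] at hi
    simp only
    split_ifs with h1'
    · exact h1 (fm _ (by omega))
    · exact h2 (gm _ (by omega))

/-! ### Spoilers and rich vertices -/

/-- For every vertex `v` there is a set of at most `B` vertices that meets every double arm whose
midpoint is adjacent to `v`. -/
def HasSpoilers (G : SimpleGraph W) (K B : ℕ) : Prop :=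
  ∀ v, ∃ X : Finset W, X.card ≤ B ∧
    ∀ z A, G.Adj v z → G.DoubleArm K z A → ¬ Disjoint A X

/-- No set of at most `R` other vertices meets all paths with `K` edges starting at `z`. -/
def Rich (G : SimpleGraph W) (K R : ℕ) (z : W) : Prop :=
  ∀ X : Finset W, X.card ≤ R → z ∉ X → ∃ A, Disjoint A X ∧ G.Arm K z A

/-- All these neighbours lie in the spoiler set `X` of `v`: otherwise richness gives an arm avoiding
`X`, then a second one also avoiding the at most `K + 1` vertices of the first, hence a double arm
missing `X`. -/
theorem HasSpoilers.card_le_of_rich {K B : ℕ} (h : G.HasSpoilers K B) (v : W) (Y : Finset W)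
    (hY : ∀ z ∈ Y, G.Adj v z ∧ G.Rich K (B + K + 1) z) : Y.card ≤ B := by
  classical
  obtain ⟨X, hXB, hX⟩ := h v
  refine (Finset.card_le_card fun z hz => ?_).trans hXB
  by_contra hzX
  obtain ⟨hvz, hr⟩ := hY z hz
  obtain ⟨A, hA, hAz⟩ := hr X (by omega) hzX
  obtain ⟨A₁, hs, hc, hA₁⟩ := hAz.exists_card_le
  obtain ⟨A₂, hA₂, hA₂z⟩ := hr (X ∪ A₁.erase z)
    (by
      have h1 := Finset.card_union_le X (A₁.erase z)
      have h2 := Finset.card_erase_le (s := A₁) (a := z)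
      omega)
    (by simp [hzX])
  rw [Finset.disjoint_union_right] at hA₂
  refine hX z (A₁ ∪ A₂) hvz ⟨A₁, Finset.subset_union_left, A₂, Finset.subset_union_right, hA₁, hA₂z,
    fun x h1 h2 => ?_⟩ (Finset.disjoint_union_left.2 ⟨Finset.disjoint_of_subset_left hs hA, hA₂.1⟩)
  by_contra hxz
  exact Finset.disjoint_left.1 hA₂.2 h2 (Finset.mem_erase.2 ⟨hxz, h1⟩)

theorem HasSpoilers.card_le_of_doubleArm {K B : ℕ} (h : G.HasSpoilers K B) (v : W) {ι : Type*}
    (I : Finset ι) (S : ι → Finset W) (hS : ∀ i ∈ I, ∀ j ∈ I, i ≠ j → Disjoint (S i) (S j))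
    (hI : ∀ i ∈ I, ∃ z, G.Adj v z ∧ G.DoubleArm K z (S i)) : I.card ≤ B := by
  obtain ⟨X, hXB, hX⟩ := h v
  refine (Finset.card_le_of_forall_not_disjoint I S X hS fun i hi => ?_).trans hXB
  obtain ⟨z, hvz, hz⟩ := hI i hi
  exact hX z _ hvz hz

theorem eq_or_exists_adj_of_edist_le_three {a b : W} (h : G.edist a b ≤ 3) :
    a = b ∨ G.Adj a b ∨ (∃ x, G.Adj a x ∧ G.Adj x b) ∨
      ∃ x y, G.Adj a x ∧ G.Adj x y ∧ G.Adj y b := by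
  obtain ⟨p, hp⟩ := exists_walk_of_edist_ne_top (ne_top_of_le_ne_top (by decide) h)
  rw [← hp] at h
  have h3 : p.length ≤ 3 := by exact_mod_cast h
  match p, h3 with
  | .nil, _ => exact Or.inl rfl
  | .cons h1 .nil, _ => exact Or.inr (Or.inl h1)
  | .cons h1 (.cons h2 .nil), _ => exact Or.inr (Or.inr (Or.inl ⟨_, h1, h2⟩))
  | .cons h1 (.cons h2 (.cons h3 .nil)), _ => exact Or.inr (Or.inr (Or.inr ⟨_, _, h1, h2, h3⟩))
  | .cons h1 (.cons h2 (.cons h3 (.cons h4 q))), h => simp at h; omega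

/-- Two anticomplete sets at distance at most three are joined through outside neighbours. -/
theorem exists_connection {C C' : Finset W} (hd : Disjoint C C')
    (hac : ∀ e ∈ C, ∀ e' ∈ C', ¬ G.Adj e e') {a b : W} (ha : a ∈ C) (hb : b ∈ C')
    (h : G.edist a b ≤ 3) :
    ∃ x y, x ∉ C ∧ x ∉ C' ∧ y ∉ C ∧ y ∉ C' ∧ (∃ e ∈ C, G.Adj x e) ∧ (∃ e ∈ C', G.Adj y e) ∧
      (x = y ∨ G.Adj x y) := by
  have hl : ∀ {x e}, e ∈ C → G.Adj x e → x ∉ C' := fun he hx hx' => hac _ he _ hx' hx.symm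
  have hr : ∀ {x e}, e ∈ C' → G.Adj x e → x ∉ C := fun he hx hx' => hac _ hx' _ he hx
  rcases eq_or_exists_adj_of_edist_le_three h with rfl | h | ⟨x, h1, h2⟩ | ⟨x, y, h1, h2, h3⟩
  · exact absurd hb (Finset.disjoint_left.1 hd ha)
  · exact absurd h (hac _ ha _ hb)
  · exact ⟨x, x, hr hb h2, hl ha h1.symm, hr hb h2, hl ha h1.symm, ⟨a, ha, h1.symm⟩, ⟨b, hb, h2⟩,
      Or.inl rfl⟩
  -- Inner vertices of the walk that already lie in `C` or `C'` are dropped.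
  · by_cases hx : x ∈ C
    · exact ⟨y, y, hr hb h3, hl hx h2.symm, hr hb h3, hl hx h2.symm, ⟨x, hx, h2.symm⟩, ⟨b, hb, h3⟩,
        Or.inl rfl⟩
    · by_cases hy : y ∈ C'
      · exact ⟨x, x, hx, hl ha h1.symm, hx, hl ha h1.symm, ⟨a, ha, h1.symm⟩, ⟨y, hy, h2⟩,
          Or.inl rfl⟩
      · exact ⟨x, y, hx, hl ha h1.symm, hr hb h3, hy, ⟨a, ha, h1.symm⟩, ⟨b, hb, h3⟩, Or.inr h2⟩

/-! ### Poor midpoints: upper bound -/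

/-- There is no large disjoint family of double arms whose midpoints are not rich. -/
theorem HasSpoilers.card_lt_of_not_rich {K B R : ℕ} (h : G.HasSpoilers K B) (hR : R = B + K + 1)
    (hG : ∀ a b, G.edist a b ≤ 3) {ι : Type*} (T : Finset ι) (u : ι → W) (A : ι → Finset W)
    (hA : ∀ s ∈ T, ∀ t ∈ T, s ≠ t → Disjoint (A s) (A t)) (harm : ∀ t ∈ T, G.Armed K (A t))
    (hu : ∀ t ∈ T, G.DoubleArm K (u t) (A t)) (huA : ∀ t ∈ T, u t ∈ A t)
    (hpoor : ∀ t ∈ T, ¬ G.Rich K R (u t)) :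
    T.card < (2 * R + 1) * ((2 * (R * B) + 1) * ((2 * (R * R) + 1) * ((2 * (R * B) + 1) * 2))) := by
  classical
  by_contra! hcard
  have hX : ∀ t, ∃ X : Finset W, t ∈ T → X.card ≤ R ∧ u t ∉ X ∧
      ∀ A, Disjoint A X → ¬ G.Arm K (u t) A := by
    intro t
    by_cases ht : t ∈ T
    · have := hpoor t ht
      unfold Rich at this
      push Not at this
      obtain ⟨X, h1, h2, h3⟩ := this
      exact ⟨X, fun _ => ⟨h1, h2, h3⟩⟩
    · exact ⟨∅, fun h => absurd h ht⟩
  choose X hX using hX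
  -- `X s` meets at most `R` of the disjoint sets `A t`.
  obtain ⟨T₂, hT₂, hc₂, hi₂⟩ := Finset.exists_independent_of_outdegree_le
    (fun s t => ¬ Disjoint (A t) (X s)) R _ T
    (fun s hs T' hT' hr => (Finset.card_le_of_forall_not_disjoint T' A (X s)
      (fun i hi j hj => hA i (hT' hi) j (hT' hj)) hr).trans (hX s hs).1) hcard
  -- By the spoilers, each of the at most `R` vertices of `X s` is adjacent to at most `B`
  -- midpoints.
  obtain ⟨T₃, hT₃, hc₃, hi₃⟩ := Finset.exists_independent_of_outdegree_le
    (fun s t => ∃ x ∈ X s, G.Adj x (u t)) (R * B) _ T₂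
    (fun s hs T' hT' hr => Finset.card_le_mul_of_forall_exists T' (X s)
      (fun x t => G.Adj x (u t)) R B (hX s (hT₂ hs)).1
      (fun x _ T'' hT'' hx => h.card_le_of_doubleArm x T'' A
        (fun i hi j hj => hA i (hT₂ (hT' (hT'' hi))) j (hT₂ (hT' (hT'' hj))))
        fun i hi => ⟨u i, hx i hi, hu i (hT₂ (hT' (hT'' hi)))⟩) hr) hc₂.ge
  have hsub : T₃ ⊆ T := hT₃.trans hT₂
  have hdis : ∀ s ∈ T₃, ∀ t ∈ T₃, s ≠ t → Disjoint (A t) (X s) := fun s hs t ht hst =>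
    not_not.1 (hi₂ s (hT₃ hs) t (hT₃ ht) hst)
  have hnadj : ∀ s ∈ T₃, ∀ t ∈ T₃, s ≠ t → ∀ x ∈ X s, ¬ G.Adj x (u t) :=
    fun s hs t ht hst x hx hxu => hi₃ s hs t ht hst ⟨x, hx, hxu⟩
  -- A short walk from `u s` to `u t` that misses `X s` after its start would extend into `A t` to
  -- an arm of `u s` avoiding `X s`. So it enters `X s` at once and, by symmetry, leaves through `X
  -- t`; as `X s` has no neighbour of `u t`, this takes exactly three edges.
  have hconn : ∀ s ∈ T₃, ∀ t ∈ T₃, s ≠ t →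
      ∃ a ∈ X s, ∃ b ∈ X t, G.Adj a b ∧ G.Adj a (u s) ∧ G.Adj b (u t) := by
    have hkey : ∀ s ∈ T₃, ∀ A', G.Armed K A' → Disjoint A' (X s) →
        ∀ z ∈ A', ¬ G.Adj (u s) z := by
      intro s hs A' hA' hd z hz hadj
      refine (hX s (hsub hs)).2.2 (insert (u s) A') ?_
        (hA'.insert hz hadj _ (Finset.mem_insert_self _ _))
      exact Finset.disjoint_insert_left.2 ⟨(hX s (hsub hs)).2.1, hd⟩
    have hkey2 : ∀ s ∈ T₃, ∀ t ∈ T₃, s ≠ t → ∀ a b, G.Adj (u s) a → G.Adj a b → G.Adj b (u t) →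
        a ∈ X s := by
      intro s hs t ht hst a b h1 h2 h3
      by_contra ha
      have hb : b ∉ X s := fun hb => hnadj s hs t ht hst b hb h3
      refine hkey s hs (insert a (insert b (A t)))
        (((harm t (hsub ht)).insert (huA t (hsub ht)) h3).insert (Finset.mem_insert_self _ _) h2)
        ?_ a (Finset.mem_insert_self _ _) h1
      simp only [Finset.disjoint_insert_left]
      exact ⟨ha, hb, hdis s hs t ht hst⟩
    intro s hs t ht hst
    rcases eq_or_exists_adj_of_edist_le_three (hG (u s) (u t)) with
      h0 | h1 | ⟨x, h1, h2⟩ | ⟨x, y, h1, h2, h3⟩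
    · exact absurd (h0 ▸ huA t (hsub ht))
        (Finset.disjoint_left.1 (hA s (hsub hs) t (hsub ht) hst) (huA s (hsub hs)))
    · exact absurd h1 (hkey s hs (A t) (harm t (hsub ht)) (hdis s hs t ht hst) _
        (huA t (hsub ht)))
    · have hx : x ∉ X s := fun hx => hnadj s hs t ht hst x hx h2
      refine absurd h1 (hkey s hs (insert x (A t))
        ((harm t (hsub ht)).insert (huA t (hsub ht)) h2)
        (Finset.disjoint_insert_left.2 ⟨hx, hdis s hs t ht hst⟩) x (Finset.mem_insert_self _ _))
    · exact ⟨x, hkey2 s hs t ht hst x y h1 h2 h3, y,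
        hkey2 t ht s hs hst.symm y x h3.symm h2.symm h1.symm, h2, h1.symm, h3⟩
  -- A poor `a` has a set `Y` of at most `R` vertices meeting its arms. The sets `A t` extended by
  -- the links `b t` are disjoint and each contains such an arm up to `a`, so `Y` meets them all.
  obtain ⟨T₄, hT₄, hc₄, hi₄⟩ := Finset.exists_independent_of_outdegree_le
    (fun s t => ∃ a ∈ X s, ¬ G.Rich K R a ∧ ∃ b ∈ X t, G.Adj a b ∧ G.Adj b (u t)) (R * R) _ T₃
    (fun s hs T' hT' hr => by
      refine Finset.card_le_mul_of_forall_exists T' (X s)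
        (fun a t => ¬ G.Rich K R a ∧ ∃ b ∈ X t, G.Adj a b ∧ G.Adj b (u t)) R R (hX s (hsub hs)).1
        ?_ hr
      intro a _ T'' hT'' hx
      rcases T''.eq_empty_or_nonempty with rfl | ⟨t₀, ht₀⟩
      · simp
      have ha := (hx t₀ ht₀).1
      unfold Rich at ha
      push Not at ha
      obtain ⟨Y, hY, haY, hYA⟩ := ha
      have hx' : ∀ t, ∃ b, t ∈ T'' → b ∈ X t ∧ G.Adj a b ∧ G.Adj b (u t) := by
        intro t
        by_cases ht : t ∈ T''
        · obtain ⟨b, hb⟩ := (hx t ht).2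
          exact ⟨b, fun _ => hb⟩
        · exact ⟨a, fun h => absurd h ht⟩
      choose b hb using hx'
      refine (Finset.card_le_of_forall_not_disjoint T'' (fun t => insert (b t) (A t)) Y ?_ ?_).trans
        hY
      · intro i hi j hj hij
        have hi' := hT' (hT'' hi)
        have hj' := hT' (hT'' hj)
        simp only [Finset.disjoint_insert_left, Finset.disjoint_insert_right, Finset.mem_insert,
          not_or]
        refine ⟨⟨fun hbb => ?_, fun hbj => ?_⟩, fun hbi => ?_, hA i (hsub hi') j (hsub hj') hij⟩
        · exact hnadj i hi' j hj' hij (b i) (hb i hi).1 (hbb ▸ (hb j hj).2.2)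
        · exact Finset.disjoint_left.1 (hdis j hj' i hi' hij.symm) hbj (hb j hj).1
        · exact Finset.disjoint_left.1 (hdis i hi' j hj' hij) hbi (hb i hi).1
      · intro t ht hd
        have ht' := hsub (hT' (hT'' ht))
        refine hYA (insert a (insert (b t) (A t))) (Finset.disjoint_insert_left.2 ⟨haY, hd⟩) ?_
        exact ((harm t ht').insert (huA t ht') (hb t ht).2.2).insert (Finset.mem_insert_self _ _)
          (hb t ht).2.1 a (Finset.mem_insert_self _ _)) hc₃.ge
  -- Each `a` has at most `B` rich neighbours, and different `t` have different links `b t` because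
  -- no vertex of `X i` is adjacent to another midpoint `u j`.
  obtain ⟨T₅, hT₅, hc₅, hi₅⟩ := Finset.exists_independent_of_outdegree_le
    (fun s t => ∃ a ∈ X s, ∃ b ∈ X t, G.Rich K R b ∧ G.Adj a b ∧ G.Adj b (u t)) (R * B) _ T₄
    (fun s hs T' hT' hr => by
      refine Finset.card_le_mul_of_forall_exists T' (X s)
        (fun a t => ∃ b ∈ X t, G.Rich K R b ∧ G.Adj a b ∧ G.Adj b (u t)) R B
        (hX s (hsub (hT₄ hs))).1 ?_ hr
      intro a _ T'' hT'' hx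
      have hx' : ∀ t, ∃ b, t ∈ T'' → b ∈ X t ∧ G.Rich K R b ∧ G.Adj a b ∧ G.Adj b (u t) := by
        intro t
        by_cases ht : t ∈ T''
        · obtain ⟨b, hb⟩ := hx t ht
          exact ⟨b, fun _ => hb⟩
        · exact ⟨a, fun h => absurd h ht⟩
      choose b hb using hx'
      rw [← Finset.card_image_of_injOn (s := T'') (f := b)]
      · refine h.card_le_of_rich a _ fun z hz => ?_
        obtain ⟨t, ht, rfl⟩ := Finset.mem_image.1 hz
        exact ⟨(hb t ht).2.2.1, hR ▸ (hb t ht).2.1⟩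
      · intro i hi j hj hij
        by_contra hne
        exact hnadj i (hT₄ (hT' (hT'' hi))) j (hT₄ (hT' (hT'' hj))) hne (b i) (hb i hi).1
          (hij ▸ (hb j hj).2.2.2)) hc₄.ge
  obtain ⟨s, hs, t, ht, hst⟩ := Finset.one_lt_card.1 (by omega : 1 < T₅.card)
  have hs' := hT₅ hs
  have ht' := hT₅ ht
  obtain ⟨a, ha, b, hb, hab, has, hbt⟩ := hconn s (hT₄ hs') t (hT₄ ht') hst
  -- If `b` is poor, the link is read backwards, from `t` to `s`.
  by_cases hbr : G.Rich K R b
  · exact hi₅ s hs t ht hst ⟨a, ha, b, hb, hbr, hab, hbt⟩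
  · exact hi₄ t ht' s hs' hst.symm ⟨b, hb, hbr, a, ha, hab.symm, has⟩

/-! ### Poor midpoints: construction -/

/-- A large disjoint family of long paths yields a large disjoint family of double arms whose
midpoints are not rich. -/
theorem HasSpoilers.exists_not_rich_family [Finite W] {K B R : ℕ} (h : G.HasSpoilers K B)
    (hR : R = B + K + 1) (hG : ∀ a b, G.edist a b ≤ 3) {ι : Type*} (I : Finset ι)
    (C S : ι → Finset W) (c m : ℕ) (hS : ∀ i ∈ I, ∀ j ∈ I, i ≠ j → Disjoint (S i) (S j))
    (hCS : ∀ i ∈ I, C i ⊆ S i) (hc : ∀ i ∈ I, (C i).card ≤ c) (harm : ∀ i ∈ I, G.Armed K (C i))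
    (hne : ∀ i ∈ I, (C i).Nonempty) (hdouble : ∀ i ∈ I, ∀ e ∈ C i, G.DoubleArm K e (S i))
    (hI : (2 * (c * B) + 1) * ((2 * (c * (B * ((B + 1) * B))) + 1) *
      (2 * ((2 * (2 * B) + 1) * m))) ≤ I.card) :
    ∃ (N : ℕ) (T : Finset (Fin N)) (u : Fin N → W) (A : Fin N → Finset W), T.card = m ∧
      (∀ s ∈ T, ∀ t ∈ T, s ≠ t → Disjoint (A s) (A t)) ∧ (∀ t ∈ T, G.Armed K (A t)) ∧
      (∀ t ∈ T, G.DoubleArm K (u t) (A t)) ∧ (∀ t ∈ T, u t ∈ A t) ∧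
      ∀ t ∈ T, ¬ G.Rich K R (u t) := by
  classical
  have := Fintype.ofFinite W
  have hnbr : ∀ v, ∀ T ⊆ I, (∀ i ∈ T, ∃ e ∈ C i, G.Adj v e) → T.card ≤ B := by
    intro v T hT hv
    refine h.card_le_of_doubleArm v T S (fun i hi j hj => hS i (hT hi) j (hT hj)) fun i hi => ?_
    obtain ⟨e, he, hve⟩ := hv i hi
    exact ⟨e, hve, hdouble i (hT hi) e he⟩
  set rn : W → Finset W := fun v => Finset.univ.filter fun z => G.Adj v z ∧ G.Rich K R z with hrn
  have hrnB : ∀ v, (rn v).card ≤ B := fun v => h.card_le_of_rich v _ fun z hz =>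
    hR ▸ (Finset.mem_filter.1 hz).2
  obtain ⟨I₁, hI₁, hc₁, hi₁⟩ := Finset.exists_independent_of_outdegree_le
    (fun i j => ∃ e ∈ C i, ∃ e' ∈ C j, G.Adj e e') (c * B) _ I
    (fun i hi T hT hr => Finset.card_le_mul_of_forall_exists T (C i)
      (fun e j => ∃ e' ∈ C j, G.Adj e e') c B (hc i hi)
      (fun e _ T' hT' => hnbr e T' (hT'.trans hT)) hr) hI
  -- Excludes connections through rich vertices only; `y = x` covers those with a single inner
  -- vertex.
  obtain ⟨I₂, hI₂, hc₂, hi₂⟩ := Finset.exists_independent_of_outdegree_le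
    (fun i j => ∃ e ∈ C i, ∃ x ∈ rn e, ∃ y ∈ insert x (rn x), ∃ e' ∈ C j, G.Adj y e')
    (c * (B * ((B + 1) * B))) _ I₁
    (fun i hi T hT hr => by
      refine Finset.card_le_mul_of_forall_exists T (C i) _ c _ (hc i (hI₁ hi)) ?_ hr
      intro e _ T₁ hT₁ hr
      refine Finset.card_le_mul_of_forall_exists T₁ (rn e) _ B _ (hrnB e) ?_ hr
      intro x _ T₂ hT₂ hr
      refine Finset.card_le_mul_of_forall_exists T₂ (insert x (rn x)) _ (B + 1) _
        ((Finset.card_insert_le _ _).trans (Nat.succ_le_succ (hrnB x))) ?_ hr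
      intro y _ T₃ hT₃ hr
      exact hnbr y T₃ (hT₃.trans (hT₂.trans (hT₁.trans (hT.trans hI₁)))) hr) hc₁.ge
  set N := (2 * (2 * B) + 1) * m with hN
  let g : Fin (2 * N) ≃ I₂ := (I₂.equivFinOfCardEq hc₂).symm
  have hgI₁ : ∀ s, (g s : ι) ∈ I₁ := fun s => hI₂ (g s).2
  have hgI : ∀ s, (g s : ι) ∈ I := fun s => hI₁ (hgI₁ s)
  have hginj : ∀ s t, s ≠ t → (g s : ι) ≠ g t := fun s t hst heq =>
    hst (g.injective (Subtype.ext heq))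
  have hCdis : ∀ s t, s ≠ t → Disjoint (C (g s)) (C (g t)) := fun s t hst =>
    Finset.disjoint_of_subset_left (hCS _ (hgI s)) (Finset.disjoint_of_subset_right (hCS _ (hgI t))
      (hS _ (hgI s) _ (hgI t) (hginj s t hst)))
  have hCanti : ∀ s t, s ≠ t → ∀ e ∈ C (g s), ∀ e' ∈ C (g t), ¬ G.Adj e e' :=
    fun s t hst e he e' he' hadj => hi₁ _ (hgI₁ s) _ (hgI₁ t) (hginj s t hst) ⟨e, he, e', he', hadj⟩
  -- The blocks `2 * s` and `2 * s + 1` are paired, and ordered so that the connector `x` next to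
  -- the first is poor. Halving an index recovers its pair.
  have hpair : ∀ s : Fin N, ∃ (i j : Fin (2 * N)) (x y : W),
      (i : ℕ) / 2 = s ∧ (j : ℕ) / 2 = s ∧ i ≠ j ∧ ¬ G.Rich K R x ∧ x ∉ C (g i) ∧ x ∉ C (g j) ∧
      y ∉ C (g i) ∧ y ∉ C (g j) ∧ (∃ e ∈ C (g i), G.Adj x e) ∧ (∃ e ∈ C (g j), G.Adj y e) ∧
      (x = y ∨ G.Adj x y) := by
    intro s
    set i : Fin (2 * N) := ⟨2 * s, by omega⟩ with hi
    set j : Fin (2 * N) := ⟨2 * s + 1, by omega⟩ with hj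
    have hi' : (i : ℕ) / 2 = s := by simp [hi]
    have hj' : (j : ℕ) / 2 = s := by simp only [hj]; omega
    have hij : i ≠ j := by simp [hi, hj]
    obtain ⟨p, hp⟩ := hne _ (hgI i)
    obtain ⟨q, hq⟩ := hne _ (hgI j)
    obtain ⟨x, y, h1, h2, h3, h4, h5, h6, h7⟩ :=
      exists_connection (hCdis i j hij) (hCanti i j hij) hp hq (hG p q)
    by_cases hx : G.Rich K R x
    · by_cases hy : G.Rich K R y
      · exfalso
        obtain ⟨e, he, hxe⟩ := h5
        refine hi₂ _ (g i).2 _ (g j).2 (hginj i j hij) ⟨e, he, x, ?_, y, ?_, h6⟩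
        · simp [hrn, hxe.symm, hx]
        · rcases h7 with rfl | h7
          · simp
          · simp [hrn, h7, hy]
      · exact ⟨j, i, y, x, hj', hi', hij.symm, hy, h4, h3, h2, h1, h6, h5,
          h7.imp Eq.symm Adj.symm⟩
    · exact ⟨i, j, x, y, hi', hj', hij, hx, h1, h2, h3, h4, h5, h6, h7⟩
  choose i j x y hi hj hij hpoor hxi hxj hyi hyj hxe hye hxy using hpair
  have hii : ∀ s t, s ≠ t → i s ≠ i t := fun s t hst h => hst (Fin.ext (by rw [← hi, ← hi, h]))
  have hjj : ∀ s t, s ≠ t → j s ≠ j t := fun s t hst h => hst (Fin.ext (by rw [← hj, ← hj, h]))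
  have hijt : ∀ s t, s ≠ t → i s ≠ j t := fun s t hst h => hst (Fin.ext (by rw [← hi, ← hj, h]))
  -- Each of the two connectors of `s` has neighbours in at most `B` other pairs. After thinning,
  -- connectors of different pairs are distinct, since each has a neighbour in its own pair.
  obtain ⟨T, -, hT, hTi⟩ := Finset.exists_independent_of_outdegree_le
    (fun s t => ∃ w ∈ ({x s, y s} : Finset W), ∃ e ∈ C (g (i t)) ∪ C (g (j t)), G.Adj w e)
    (2 * B) m (Finset.univ : Finset (Fin N))
    (fun s _ T _ hr => by
      refine Finset.card_le_mul_of_forall_exists T _ _ 2 B Finset.card_le_two ?_ hr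
      intro w _ T' _ hr
      refine h.card_le_of_doubleArm w T' (fun t => S (g (i t)) ∪ S (g (j t))) ?_ ?_
      · intro s _ t _ hst
        have hS' : ∀ a b, a ≠ b → Disjoint (S (g a)) (S (g b)) := fun a b hab =>
          hS _ (hgI a) _ (hgI b) (hginj a b hab)
        simp only [Finset.disjoint_union_left, Finset.disjoint_union_right]
        exact ⟨⟨hS' _ _ (hii s t hst), hS' _ _ (hijt t s hst.symm).symm⟩,
          hS' _ _ (hijt s t hst), hS' _ _ (hjj s t hst)⟩
      · intro t ht
        obtain ⟨e, he, hwe⟩ := hr t ht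
        refine ⟨e, hwe, ?_⟩
        rcases Finset.mem_union.1 he with he | he
        · exact (hdouble _ (hgI _) e he).mono Finset.subset_union_left
        · exact (hdouble _ (hgI _) e he).mono Finset.subset_union_right) (by simp [hN])
  have hout : ∀ s t, s ≠ t → ∀ w ∈ ({x s, y s} : Finset W), w ∉ C (g (i t)) ∧ w ∉ C (g (j t)) := by
    intro s t hst w hw
    rcases Finset.mem_insert.1 hw with rfl | hw
    · obtain ⟨e, he, hwe⟩ := hxe s
      exact ⟨fun hwt => hCanti _ _ (hii s t hst) e he _ hwt hwe.symm,
        fun hwt => hCanti _ _ (hijt s t hst) e he _ hwt hwe.symm⟩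
    · obtain rfl := Finset.mem_singleton.1 hw
      obtain ⟨e, he, hwe⟩ := hye s
      exact ⟨fun hwt => hCanti _ _ (hijt t s hst.symm).symm e he _ hwt hwe.symm,
        fun hwt => hCanti _ _ (hjj s t hst) e he _ hwt hwe.symm⟩
  refine ⟨N, T, x, fun s => {x s, y s} ∪ (C (g (i s)) ∪ C (g (j s))), hT, ?_, ?_, ?_, ?_,
    fun t _ => hpoor t⟩
  · intro s hs t ht hst
    simp only [Finset.disjoint_union_left, Finset.disjoint_union_right]
    refine ⟨⟨?_, ?_, ?_⟩, ⟨?_, hCdis _ _ (hii s t hst), hCdis _ _ (hijt t s hst.symm).symm⟩,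
      ?_, hCdis _ _ (hijt s t hst), hCdis _ _ (hjj s t hst)⟩
    · rw [Finset.disjoint_left]
      intro w hws hwt
      refine hTi s hs t ht hst ⟨w, hws, ?_⟩
      rcases Finset.mem_insert.1 hwt with rfl | hwt
      · obtain ⟨e, he, hwe⟩ := hxe t
        exact ⟨e, Finset.mem_union_left _ he, hwe⟩
      · obtain rfl := Finset.mem_singleton.1 hwt
        obtain ⟨e, he, hwe⟩ := hye t
        exact ⟨e, Finset.mem_union_right _ he, hwe⟩
    · exact Finset.disjoint_right.2 fun w hw => (hout t s hst.symm w hw).1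
    · exact Finset.disjoint_right.2 fun w hw => (hout t s hst.symm w hw).2
    · exact Finset.disjoint_left.2 fun w hw => (hout s t hst w hw).1
    · exact Finset.disjoint_left.2 fun w hw => (hout s t hst w hw).2
  · intro t _
    obtain ⟨e, he, hxe⟩ := hxe t
    obtain ⟨e', he', hye⟩ := hye t
    have h1 := (harm _ (hgI (i t))).union (harm _ (hgI (j t)))
    have h2 := h1.insert (Finset.mem_union_right _ he') hye
    have h3 := h2.insert (Finset.mem_insert_of_mem (Finset.mem_union_left _ he)) hxe
    simpa only [Finset.insert_union, Finset.singleton_union] using h3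
  · intro t _
    obtain ⟨e, he, hxe⟩ := hxe t
    obtain ⟨e', he', hye⟩ := hye t
    -- One arm of `x t` runs directly into the first block, the other, through `y t` if that
    -- differs, into the second.
    have a1 : G.Arm K (x t) (insert (x t) (C (g (i t)))) :=
      (harm _ (hgI (i t)) e he).cons (hxi t) hxe
    have a2 : G.Arm K (x t) (insert (x t) (insert (y t) (C (g (j t))))) := by
      have h1 := (harm _ (hgI (j t))).insert he' hye
      rcases hxy t with heq | hadj
      · rw [heq]
        exact (h1 _ (Finset.mem_insert_self _ _)).mono (Finset.subset_insert _ _)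
      · exact h1.insert (Finset.mem_insert_self _ _) hadj _ (Finset.mem_insert_self _ _)
    refine ⟨_, ?_, _, ?_, a1, a2, ?_⟩
    · intro w
      simp only [Finset.mem_insert, Finset.mem_union, Finset.mem_singleton]
      tauto
    · intro w
      simp only [Finset.mem_insert, Finset.mem_union, Finset.mem_singleton]
      tauto
    · intro w hw1 hw2
      by_contra hne
      have hw1 := (Finset.mem_insert.1 hw1).resolve_left hne
      rcases Finset.mem_insert.1 ((Finset.mem_insert.1 hw2).resolve_left hne) with rfl | hw2
      · exact hyi t hw1
      · exact Finset.disjoint_left.1 (hCdis _ _ (hij t)) hw1 hw2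
  · intro t _
    simp

/-! ### Cutting a long path into blocks -/

theorem arm_image_Icc_up [DecidableEq W] {N K t : ℕ} {p : ℕ → W}
    (hp : ∀ i < N, ∀ j < N, p i = p j → i = j)
    (ha : ∀ i, i + 1 < N → G.Adj (p i) (p (i + 1))) (ht : t + K < N) :
    G.Arm K (p t) ((Finset.Icc t (t + K)).image p) := by
  refine ⟨fun i => p (t + i), rfl, fun i hi j hj hij => ?_, fun i hi => ha _ (by omega),
    fun i hi => Finset.mem_image_of_mem _ (Finset.mem_Icc.2 ⟨by omega, by omega⟩)⟩
  have := hp _ (by omega) _ (by omega) hij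
  omega

theorem arm_image_Icc_down [DecidableEq W] {N K t : ℕ} {p : ℕ → W}
    (hp : ∀ i < N, ∀ j < N, p i = p j → i = j)
    (ha : ∀ i, i + 1 < N → G.Adj (p i) (p (i + 1))) (ht : t < N) (hK : K ≤ t) :
    G.Arm K (p t) ((Finset.Icc (t - K) t).image p) := by
  refine ⟨fun i => p (t - i), rfl, fun i hi j hj hij => ?_, fun i hi => ?_,
    fun i hi => Finset.mem_image_of_mem _ (Finset.mem_Icc.2 ⟨by omega, by omega⟩)⟩
  · have := hp _ (by omega) _ (by omega) hij
    omega
  · have := ha (t - (i + 1)) (by omega)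
    rw [show t - (i + 1) + 1 = t - i by omega] at this
    exact this.symm

/-- In graphs of diameter at most three with spoilers, the paths have bounded length. -/
theorem exists_path_bound_of_hasSpoilers (K B : ℕ) : ∃ N : ℕ, ∀ (W : Type v) [Finite W]
    (G : SimpleGraph W), G.HasSpoilers K B → (∀ a b, G.edist a b ≤ 3) → ∀ p : ℕ → W,
    (∀ i < N, ∀ j < N, p i = p j → i = j) → ¬ ∀ i, i + 1 < N → G.Adj (p i) (p (i + 1)) := by
  classical
  obtain ⟨R, hR⟩ : ∃ R, R = B + K + 1 := ⟨_, rfl⟩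
  obtain ⟨m, hm⟩ : ∃ m, m = (2 * R + 1) *
    ((2 * (R * B) + 1) * ((2 * (R * R) + 1) * ((2 * (R * B) + 1) * 2))) := ⟨_, rfl⟩
  obtain ⟨M, hM⟩ : ∃ M, M = (2 * ((2 * K + 1) * B) + 1) *
    ((2 * ((2 * K + 1) * (B * ((B + 1) * B))) + 1) * (2 * ((2 * (2 * B) + 1) * m))) := ⟨_, rfl⟩
  obtain ⟨N, hN⟩ : ∃ N, N = (4 * K + 1) * M := ⟨_, rfl⟩
  refine ⟨N, fun W _ G h hG p hp ha => ?_⟩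
  have hlt : ∀ i ∈ Finset.range M, (4 * K + 1) * i + 4 * K < N := by
    intro i hi
    have : (4 * K + 1) * (i + 1) ≤ N := hN ▸ Nat.mul_le_mul_left _ (Finset.mem_range.1 hi)
    rw [mul_add] at this
    omega
  -- In a block of `4 * K + 1` vertices, the middle `2 * K + 1` have `K` further vertices on either
  -- side.
  have hfam := h.exists_not_rich_family hR hG (Finset.range M)
    (fun i => (Finset.Icc ((4 * K + 1) * i + K) ((4 * K + 1) * i + 3 * K)).image p)
    (fun i => (Finset.Icc ((4 * K + 1) * i) ((4 * K + 1) * i + 4 * K)).image p) (2 * K + 1) m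
  obtain ⟨n, T, u, A, hT, h1, h2, h3, h4, h5⟩ := by
    refine hfam ?_ ?_ ?_ ?_ ?_ ?_ (by rw [Finset.card_range, hM])
    · intro i hi j hj hij
      rw [Finset.disjoint_left]
      intro x hx hx'
      obtain ⟨a, ha, rfl⟩ := Finset.mem_image.1 hx
      obtain ⟨b, hb, hab⟩ := Finset.mem_image.1 hx'
      have hi' := hlt i hi
      have hj' := hlt j hj
      rw [Finset.mem_Icc] at ha hb
      have := hp b (by omega) a (by omega) hab
      subst this
      rcases Nat.lt_or_gt_of_ne hij with hij | hij
      · have := Nat.mul_le_mul_left (4 * K + 1) (Nat.succ_le_of_lt hij)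
        rw [Nat.succ_eq_add_one, mul_add] at this
        omega
      · have := Nat.mul_le_mul_left (4 * K + 1) (Nat.succ_le_of_lt hij)
        rw [Nat.succ_eq_add_one, mul_add] at this
        omega
    · intro i hi
      exact Finset.image_subset_image (Finset.Icc_subset_Icc (by omega) (by omega))
    · intro i hi
      refine Finset.card_image_le.trans ?_
      rw [Nat.card_Icc]
      omega
    · intro i hi z hz
      obtain ⟨t, ht, rfl⟩ := Finset.mem_image.1 hz
      have hi' := hlt i hi
      rw [Finset.mem_Icc] at ht
      by_cases htm : t ≤ (4 * K + 1) * i + 2 * K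
      · exact (arm_image_Icc_up hp ha (by omega)).mono
          (Finset.image_subset_image (Finset.Icc_subset_Icc (by omega) (by omega)))
      · exact (arm_image_Icc_down hp ha (by omega) (by omega)).mono
          (Finset.image_subset_image (Finset.Icc_subset_Icc (by omega) (by omega)))
    · intro i hi
      exact ((Finset.nonempty_Icc.2 (by omega))).image _
    · intro i hi z hz
      obtain ⟨t, ht, rfl⟩ := Finset.mem_image.1 hz
      have hi' := hlt i hi
      rw [Finset.mem_Icc] at ht
      refine ⟨_, ?_, _, ?_, arm_image_Icc_up hp ha (K := K) (t := t) (by omega),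
        arm_image_Icc_down hp ha (K := K) (t := t) (by omega) (by omega), ?_⟩
      · exact Finset.image_subset_image (Finset.Icc_subset_Icc (by omega) (by omega))
      · exact Finset.image_subset_image (Finset.Icc_subset_Icc (by omega) (by omega))
      · intro x hx hx'
        obtain ⟨a, ha, rfl⟩ := Finset.mem_image.1 hx
        obtain ⟨b, hb, hab⟩ := Finset.mem_image.1 hx'
        rw [Finset.mem_Icc] at ha hb
        have := hp b (by omega) a (by omega) hab
        rw [show a = t by omega]
  exact absurd (h.card_lt_of_not_rich hR hG T u A h1 h2 h3 h4 h5)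
    (by rw [hT, hm]; exact lt_irrefl _)

end SimpleGraph

/-! ### Embedding an apex linear forest -/

namespace SimpleGraph

variable {V : Type u} {W : Type v} {G : SimpleGraph W}

/-- In a linear forest, the vertices of each component can be numbered along the path. -/
theorem IsLinearForest.exists_index [Finite V] {H : SimpleGraph V} (hH : H.IsLinearForest) :
    ∃ idx : V → ℕ, (∀ w, idx w < Nat.card V) ∧
      (∀ w w', H.Reachable w w' → idx w = idx w' → w = w') ∧
      ∀ w w', H.Adj w w' → idx w' = idx w + 1 ∨ idx w = idx w' + 1 := by
  choose n e using hH
  let e' := fun C => (e C).some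
  have key : ∀ (C : H.ConnectedComponent) w (hw : w ∈ C),
      (e' (H.connectedComponentMk w) ⟨w, rfl⟩ : ℕ) = e' C ⟨w, hw⟩ := by
    intro C w hw
    obtain rfl : H.connectedComponentMk w = C := hw
    rfl
  refine ⟨fun w => e' (H.connectedComponentMk w) ⟨w, rfl⟩, fun w => ?_, fun w w' h hidx => ?_,
    fun w w' h => ?_⟩
  · refine (e' _ _).2.trans_le ?_
    have h1 := Nat.card_congr (e' (H.connectedComponentMk w)).toEquiv
    rw [Nat.card_fin] at h1
    rw [← h1]
    exact Finite.card_subtype_le _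
  · have hw : w' ∈ H.connectedComponentMk w := ConnectedComponent.sound h.symm
    simp only [key _ w' hw] at hidx
    have := (e' (H.connectedComponentMk w)).injective (Fin.ext hidx)
    exact congrArg Subtype.val this
  · have hw : w' ∈ H.connectedComponentMk w := ConnectedComponent.sound h.symm.reachable
    simp only [key _ w' hw]
    have hadj : (H.connectedComponentMk w).toSimpleGraph.Adj ⟨w, rfl⟩ ⟨w', hw⟩ := h
    have := pathGraph_adj.1 ((e' _).map_adj_iff.2 hadj)
    omega

/-- In an acyclic graph a vertex has at most one neighbour in each component of the rest. -/
theorem IsAcyclic.eq_of_adj_of_reachable_induce {F : SimpleGraph V} (hF : F.IsAcyclic) {x : V}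
    {w w' : ({x}ᶜ : Set V)} (hr : (F.induce {x}ᶜ).Reachable w w') (hw : F.Adj x w)
    (hw' : F.Adj x w') : w = w' := by
  classical
  by_contra hne
  obtain ⟨p, hp⟩ := hr.exists_isPath
  let φ : F.induce ({x}ᶜ : Set V) →g F := (Embedding.induce _).toHom
  have hq : (p.map φ).IsPath := hp.map Subtype.val_injective
  have hxq : x ∉ (p.map φ).support := by
    intro hx
    rw [Walk.support_map] at hx
    obtain ⟨y, -, hy⟩ := List.mem_map.1 hx
    exact y.2 hy
  have hne' : (w : V) ≠ w' := fun h => hne (Subtype.ext h)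
  -- A second path between `w` and `w'`, this one through `x`.
  have hr : (Walk.cons hw.symm (Walk.cons hw' Walk.nil)).IsPath := by
    simp [Walk.cons_isPath_iff, hw'.ne, hw.ne', hne']
  have heq : p.map φ = Walk.cons hw.symm (Walk.cons hw' Walk.nil) :=
    congrArg Subtype.val ((hF.subsingleton_path (w : V) w').elim ⟨p.map φ, hq⟩ ⟨_, hr⟩)
  refine hxq ?_
  rw [heq]
  exact List.mem_cons_of_mem _ List.mem_cons_self

/-- Without spoilers, some vertex is the centre of many disjoint double arms. -/
theorem exists_disjoint_doubleArms {K B n : ℕ} {v : W} (hB : n * (2 * K + 2) + 1 ≤ B)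
    (h : ∀ X : Finset W, X.card ≤ B → ∃ z A, G.Adj v z ∧ G.DoubleArm K z A ∧ Disjoint A X)
    (m : ℕ) (hm : m ≤ n) : ∃ (z : ℕ → W) (A : ℕ → Finset W),
      (∀ i < m, G.Adj v (z i) ∧ G.DoubleArm K (z i) (A i) ∧ v ∉ A i ∧ (A i).card ≤ 2 * K + 2) ∧
      ∀ i < m, ∀ j < m, i ≠ j → Disjoint (A i) (A j) := by
  classical
  induction m with
  | zero => exact ⟨fun _ => v, fun _ => ∅, by simp, by simp⟩
  | succ m ih =>
    obtain ⟨z, A, h1, h2⟩ := ih (by omega)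
    set Y := (Finset.range m).biUnion A
    have hY : Y.card ≤ m * (2 * K + 2) := by
      have := Finset.card_biUnion_le_card_mul (Finset.range m) A (2 * K + 2)
        fun i hi => (h1 i (Finset.mem_range.1 hi)).2.2.2
      rwa [Finset.card_range] at this
    -- The next double arm must avoid `v` and all earlier ones.
    obtain ⟨z', A', h3, h4, h5⟩ := h (insert v Y) (by
      have h6 := Finset.card_insert_le v Y
      have h7 := Nat.mul_le_mul_right (2 * K + 2) (show m ≤ n by omega)
      omega)
    obtain ⟨A'', hs, hc, h4⟩ := h4.exists_card_le
    have h5 := Finset.disjoint_of_subset_left hs h5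
    rw [Finset.disjoint_insert_right] at h5
    have h6 : ∀ i < m, Disjoint A'' (A i) := fun i hi =>
      Finset.disjoint_of_subset_right
        (Finset.subset_biUnion_of_mem A (Finset.mem_range.2 hi)) h5.2
    refine ⟨Function.update z m z', Function.update A m A'', ?_, ?_⟩
    · intro i hi
      rcases Nat.lt_succ_iff_lt_or_eq.1 hi with hi | rfl
      · simpa [hi.ne] using h1 i hi
      · simpa using ⟨h3, h4, h5.1, hc⟩
    · intro i hi j hj hij
      rcases Nat.lt_succ_iff_lt_or_eq.1 hi with hi | rfl <;>
        rcases Nat.lt_succ_iff_lt_or_eq.1 hj with hj | rfl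
      · simpa [hi.ne, hj.ne] using h2 i hi j hj hij
      · simpa [hi.ne] using (h6 i hi).symm
      · simpa [hj.ne] using h6 j hj
      · exact absurd rfl hij

/-- A graph without a given acyclic apex linear forest as a subgraph has spoilers. -/
theorem IsAcyclic.hasSpoilers_of_free [Finite V] {F : SimpleGraph V} (hF : F.IsAcyclic)
    (hA : F.IsApexLinearForest) (hG : F.Free G) :
    G.HasSpoilers (Nat.card V) (Nat.card V * (2 * Nat.card V + 2) + 1) := by
  classical
  obtain ⟨x, hx⟩ := hA
  set K := Nat.card V with hK
  by_contra hns
  unfold HasSpoilers at hns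
  push Not at hns
  obtain ⟨v, hv⟩ := hns
  obtain ⟨z, A, h1, h2⟩ := exists_disjoint_doubleArms le_rfl hv K le_rfl
  have hq : ∀ i, ∃ q : ℤ → W, i < K → q 0 = z i ∧
      (∀ a b : ℤ, |a| ≤ K → |b| ≤ K → q a = q b → a = b) ∧
      (∀ a : ℤ, |a| ≤ K → |a + 1| ≤ K → G.Adj (q a) (q (a + 1))) ∧
      ∀ a : ℤ, |a| ≤ K → q a ∈ A i := by
    intro i
    by_cases hi : i < K
    · obtain ⟨q, hq⟩ := (h1 i hi).2.1.exists_int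
      exact ⟨q, fun _ => hq⟩
    · exact ⟨fun _ => v, fun h => absurd h hi⟩
  choose q hq using hq
  obtain ⟨idx, hlt, hinj, hadj⟩ := hx.exists_index
  set H := F.induce ({x}ᶜ : Set V) with hH
  have hcard : Nat.card ({x}ᶜ : Set V) ≤ K := Finite.card_subtype_le _
  have hcomp : Nat.card H.ConnectedComponent ≤ K :=
    (Nat.card_le_card_of_surjective H.connectedComponentMk Quot.mk_surjective).trans hcard
  let σ : ({x}ᶜ : Set V) → ℕ := fun w => Finite.equivFin _ (H.connectedComponentMk w)
  have hσ : ∀ w, σ w < K := fun w => (Fin.isLt _).trans_le hcomp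
  have hσr : ∀ w w', σ w = σ w' ↔ H.Reachable w w' := by
    intro w w'
    rw [← ConnectedComponent.eq]
    simp only [σ, Fin.val_inj, EmbeddingLike.apply_eq_iff_eq]
  -- `c C` is the index of the only neighbour of `x` in `C`, to be placed at the midpoint; without
  -- such a neighbour it is 0.
  have hc : ∀ C : H.ConnectedComponent, ∃ c < K + 1, ∀ w, H.connectedComponentMk w = C →
      F.Adj x w → idx w = c := by
    intro C
    by_cases hC : ∃ w, H.connectedComponentMk w = C ∧ F.Adj x w
    · obtain ⟨w, rfl, hw⟩ := hC
      refine ⟨idx w, by have := hlt w; omega, fun w' hw' hxw' => ?_⟩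
      rw [hF.eq_of_adj_of_reachable_induce (ConnectedComponent.exact hw') hxw' hw]
    · push Not at hC
      exact ⟨0, by omega, fun w hw hxw => absurd hxw (hC w hw)⟩
  choose c hcK hc using hc
  let pos : ({x}ᶜ : Set V) → ℤ := fun w => (idx w : ℤ) - c (H.connectedComponentMk w)
  have hpos : ∀ w, |pos w| ≤ K := by
    intro w
    have h3 := hlt w
    have h4 := hcK (H.connectedComponentMk w)
    rw [abs_le]
    simp only [pos]
    omega
  let f : V → W := fun y => if hy : y = x then v else q (σ ⟨y, hy⟩) (pos ⟨y, hy⟩)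
  have hfx : f x = v := by simp [f]
  have hf : ∀ w : ({x}ᶜ : Set V), f w = q (σ w) (pos w) := fun w => dif_neg w.2
  have hmem : ∀ w : ({x}ᶜ : Set V), f w ∈ A (σ w) := fun w => by
    rw [hf]
    exact (hq _ (hσ w)).2.2.2 _ (hpos w)
  have hfv : ∀ w : ({x}ᶜ : Set V), f w ≠ v := fun w heq =>
    (h1 _ (hσ w)).2.2.1 (heq ▸ hmem w)
  have hfinj : Function.Injective f := by
    intro y y' hyy
    by_cases hy : y = x <;> by_cases hy' : y' = x
    · rw [hy, hy']
    · rw [hy, hfx] at hyy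
      exact absurd hyy.symm (hfv ⟨y', hy'⟩)
    · rw [hy', hfx] at hyy
      exact absurd hyy (hfv ⟨y, hy⟩)
    · have hσσ : σ ⟨y, hy⟩ = σ ⟨y', hy'⟩ := by
        by_contra hne
        refine Finset.disjoint_left.1 (h2 _ (hσ ⟨y, hy⟩) _ (hσ ⟨y', hy'⟩) hne) (hmem ⟨y, hy⟩) ?_
        simp only
        rw [hyy]
        exact hmem ⟨y', hy'⟩
      have hr := (hσr _ _).1 hσσ
      have h3 := hf ⟨y, hy⟩
      have h4 := hf ⟨y', hy'⟩
      simp only at h3 h4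
      rw [h3, h4, hσσ] at hyy
      have h5 := (hq _ (hσ _)).2.1 _ _ (hpos _) (hpos _) hyy
      simp only [pos, ConnectedComponent.sound hr] at h5
      exact congrArg Subtype.val (hinj _ _ hr (by omega))
  have hxadj : ∀ w : ({x}ᶜ : Set V), F.Adj x w → G.Adj v (f w) := by
    intro w hxw
    have hp0 : pos w = 0 := by simp only [pos, hc _ w rfl hxw]; omega
    rw [hf, hp0, (hq _ (hσ w)).1]
    exact (h1 _ (hσ w)).1
  have hwadj : ∀ w w' : ({x}ᶜ : Set V), H.Adj w w' → idx w' = idx w + 1 → G.Adj (f w) (f w') := by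
    intro w w' hww hidx
    have hr : H.Reachable w w' := hww.reachable
    have hp1 : pos w' = pos w + 1 := by
      simp only [pos, ConnectedComponent.sound hr]
      omega
    rw [hf, hf, ← (hσr _ _).2 hr, hp1]
    exact (hq _ (hσ w)).2.2.1 _ (hpos w) (hp1 ▸ hpos w')
  refine hG ⟨⟨⟨f, ?_⟩, hfinj⟩⟩
  intro y y' hyy
  by_cases hy : y = x <;> by_cases hy' : y' = x
  · exact absurd (hy.trans hy'.symm) hyy.ne
  · rw [hy, hfx]
    exact hxadj ⟨y', hy'⟩ (hy ▸ hyy)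
  · rw [hy', hfx]
    exact (hxadj ⟨y, hy⟩ (hy' ▸ hyy.symm)).symm
  · have hH' : H.Adj ⟨y, hy⟩ ⟨y', hy'⟩ := hyy
    rcases hadj _ _ hH' with h | h
    · exact hwadj _ _ hH' h
    · exact (hwadj _ _ hH'.symm h).symm

end SimpleGraph

/-! ### Depth and reattachment in rooted forests -/

namespace RootedForest

variable {W : Type v} {T : RootedForest W}

/-- The depth as a natural number, meaningful for finite vertex sets. -/
noncomputable def natDepth (T : RootedForest W) (b : W) : ℕ :=
  {a | T.IsAncestor a b}.ncard

theorem natDepth_eq_depth [Finite W] (T : RootedForest W) (b : W) :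
    (T.natDepth b : ℕ∞) = T.depth b :=
  Set.Finite.cast_ncard_eq (Set.toFinite _)

theorem isAncestor_iff_of_parent_eq_some {a b x : W} (h : T.parent b = some a) :
    T.IsAncestor x b ↔ x = b ∨ T.IsAncestor x a := by
  constructor
  · intro hx
    rcases Relation.ReflTransGen.cases_tail hx with rfl | ⟨c, hc, hcb⟩
    · exact Or.inl rfl
    · rw [h, Option.some_inj] at hcb
      exact Or.inr (hcb ▸ hc)
  · rintro (rfl | hx)
    · exact Relation.ReflTransGen.refl
    · exact Relation.ReflTransGen.tail hx h

theorem isAncestor_iff_of_parent_eq_none {b x : W} (h : T.parent b = none) :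
    T.IsAncestor x b ↔ x = b := by
  constructor
  · intro hx
    rcases Relation.ReflTransGen.cases_tail hx with rfl | ⟨c, hc, hcb⟩
    · rfl
    · rw [h] at hcb
      cases hcb
  · rintro rfl
    exact Relation.ReflTransGen.refl

theorem not_isAncestor_of_parent_eq_some {a b : W} (h : T.parent b = some a) :
    ¬ T.IsAncestor b a := fun hba =>
  T.wellFounded.transGen.irrefl.irrefl b (Relation.TransGen.tail' hba h)

theorem natDepth_of_parent_eq_none {b : W} (h : T.parent b = none) : T.natDepth b = 1 := by
  simp [natDepth, isAncestor_iff_of_parent_eq_none h]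

theorem natDepth_of_parent_eq_some [Finite W] {a b : W} (h : T.parent b = some a) :
    T.natDepth b = T.natDepth a + 1 := by
  have : {x | T.IsAncestor x b} = insert b {x | T.IsAncestor x a} := by
    ext x
    exact isAncestor_iff_of_parent_eq_some h
  have hb : b ∉ {x | T.IsAncestor x a} := not_isAncestor_of_parent_eq_some h
  rw [natDepth, this, Set.ncard_insert_of_notMem hb, natDepth]

theorem one_le_natDepth [Finite W] (T : RootedForest W) (b : W) : 1 ≤ T.natDepth b :=
  (Set.ncard_pos (Set.toFinite _)).2 ⟨b, Relation.ReflTransGen.refl⟩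

theorem IsAncestor.natDepth_le [Finite W] {a b : W} (h : T.IsAncestor a b) :
    T.natDepth a ≤ T.natDepth b :=
  Set.ncard_le_ncard fun _ hx => Relation.ReflTransGen.trans hx h

theorem IsAncestor.eq_of_natDepth_le [Finite W] {a b : W} (h : T.IsAncestor a b)
    (hd : T.natDepth b ≤ T.natDepth a) : a = b := by
  rcases Relation.ReflTransGen.cases_tail h with rfl | ⟨c, hc, hcb⟩
  · rfl
  · have h1 := natDepth_of_parent_eq_some hcb
    have h2 : T.natDepth a ≤ T.natDepth c := IsAncestor.natDepth_le hc
    omega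

theorem IsAncestor.total {a b x : W} (ha : T.IsAncestor a x) (hb : T.IsAncestor b x) :
    T.IsAncestor a b ∨ T.IsAncestor b a := by
  induction x using T.wellFounded.induction with
  | _ x ih =>
    cases hx : T.parent x with
    | none =>
      rw [isAncestor_iff_of_parent_eq_none hx] at ha hb
      exact Or.inl (ha ▸ hb ▸ Relation.ReflTransGen.refl)
    | some c =>
      rcases (isAncestor_iff_of_parent_eq_some hx).1 ha with rfl | ha'
      · exact Or.inr hb
      · rcases (isAncestor_iff_of_parent_eq_some hx).1 hb with rfl | hb'
        · exact Or.inl ha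
        · exact ih c hx ha' hb'

theorem parent_injective : Function.Injective (parent : RootedForest W → W → Option W) := by
  rintro ⟨p, hp⟩ ⟨q, hq⟩ h
  cases h
  rfl

instance [Finite W] : Finite (RootedForest W) := Finite.of_injective _ parent_injective

/-- Making `u` the parent of `v`, where `v` is not an ancestor of `u`. -/
noncomputable def reattach (T : RootedForest W) (u v : W) (h : ¬ T.IsAncestor v u) :
    RootedForest W where
  parent := open Classical in Function.update T.parent v (some u)
  wellFounded := by
    classical
    -- Vertices not below `v` keep their path to the root, and `u` is one of them.
    have h1 : ∀ w, ¬ T.IsAncestor v w →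
        Acc (fun a b => Function.update T.parent v (some u) b = some a) w := by
      intro w
      induction w using T.wellFounded.induction with
      | _ w ih =>
        intro hw
        refine ⟨_, fun a ha => ?_⟩
        have hwv : w ≠ v := fun hwv => hw (hwv ▸ Relation.ReflTransGen.refl)
        rw [Function.update_of_ne hwv] at ha
        exact ih a ha fun hva => hw (Relation.ReflTransGen.tail hva ha)
    refine ⟨fun w => ?_⟩
    induction w using T.wellFounded.induction with
    | _ w ih =>
      refine ⟨_, fun a ha => ?_⟩
      by_cases hwv : w = v
      · rw [hwv, Function.update_self, Option.some_inj] at ha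
        exact h1 a (ha ▸ h)
      · rw [Function.update_of_ne hwv] at ha
        exact ih a ha

theorem reattach_parent_self {u v : W} (h : ¬ T.IsAncestor v u) :
    (T.reattach u v h).parent v = some u := by
  simp [reattach]

theorem reattach_parent_of_ne {u v w : W} (h : ¬ T.IsAncestor v u) (hw : w ≠ v) :
    (T.reattach u v h).parent w = T.parent w := by
  simp [reattach, hw]

theorem natDepth_le_reattach [Finite W] {u v : W} (h : ¬ T.IsAncestor v u)
    (hd : T.natDepth v ≤ T.natDepth u) (w : W) :
    T.natDepth w ≤ (T.reattach u v h).natDepth w := by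
  induction w using (T.reattach u v h).wellFounded.induction with
  | _ w ih =>
    by_cases hw : w = v
    · subst hw
      have h1 := ih u (reattach_parent_self h)
      have h2 := natDepth_of_parent_eq_some (reattach_parent_self h)
      omega
    · have hp := reattach_parent_of_ne h hw
      cases hx : T.parent w with
      | none => rw [natDepth_of_parent_eq_none hx, natDepth_of_parent_eq_none (hp.trans hx)]
      | some a =>
        have h1 := ih a (hp.trans hx)
        rw [natDepth_of_parent_eq_some hx, natDepth_of_parent_eq_some (hp.trans hx)]
        omega

theorem natDepth_lt_reattach_self [Finite W] {u v : W} (h : ¬ T.IsAncestor v u)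
    (hd : T.natDepth v ≤ T.natDepth u) : T.natDepth v < (T.reattach u v h).natDepth v := by
  have h1 := natDepth_le_reattach h hd u
  have h2 := natDepth_of_parent_eq_some (reattach_parent_self h)
  omega

/-- The beginning of the path from a vertex to its root. -/
theorem exists_parent_sequence [Finite W] (T : RootedForest W) (n : ℕ) (b : W)
    (hn : n ≤ T.natDepth b) : ∃ p : ℕ → W, p 0 = b ∧
      (∀ i, i + 1 < n → T.parent (p i) = some (p (i + 1))) ∧
      ∀ i < n, T.natDepth (p i) + i = T.natDepth b := by
  induction n generalizing b with
  | zero => exact ⟨fun _ => b, rfl, by simp, by simp⟩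
  | succ n ih =>
    cases hb : T.parent b with
    | none =>
      rw [natDepth_of_parent_eq_none hb] at hn
      exact ⟨fun _ => b, rfl, fun i hi => by omega, fun i hi => by
        obtain rfl : i = 0 := by omega
        rfl⟩
    | some a =>
      have hba := natDepth_of_parent_eq_some hb
      obtain ⟨p, h0, h1, h2⟩ := ih a (by omega)
      refine ⟨fun i => Nat.casesOn i b p, rfl, ?_, ?_⟩
      · rintro (_ | i) hi
        · simpa [h0] using hb
        · exact h1 i (by omega)
      · rintro (_ | i) hi
        · rfl
        · have := h2 i (by omega)
          simp only
          omega

end RootedForest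

/-! ### Treedepth and paths -/

namespace SimpleGraph

variable {W : Type v} {G : SimpleGraph W}

/-- A finite graph has an elimination forest in which children are adjacent to their parents. -/
theorem exists_isEliminationForest_parent_adj [Finite W] (G : SimpleGraph W) :
    ∃ T : RootedForest W, G.IsEliminationForest T ∧ ∀ a b, T.parent b = some a → G.Adj b a := by
  have := Fintype.ofFinite W
  let 𝒯 := {T : RootedForest W // ∀ a b, T.parent b = some a → G.Adj b a}
  have hne : Nonempty 𝒯 := ⟨⟨⟨fun _ => none, ⟨fun a => ⟨_, fun b hb => by cases hb⟩⟩⟩,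
    fun a b h => by cases h⟩⟩
  -- With the depth sum maximal, an edge `uv` with incomparable ends would allow the end that is no
  -- deeper to be reattached below the other, increasing the sum.
  obtain ⟨⟨T, hT⟩, hmax⟩ := Finite.exists_max fun T : 𝒯 => ∑ b, T.1.natDepth b
  have key : ∀ u v, G.Adj u v → T.natDepth v ≤ T.natDepth u → T.IsAncestor v u := by
    intro u v huv hd
    by_contra h
    refine (hmax ⟨T.reattach u v h, fun a b hab => ?_⟩).not_gt ?_
    · by_cases hb : b = v
      · subst hb
        rw [RootedForest.reattach_parent_self, Option.some_inj] at hab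
        exact hab ▸ huv.symm
      · rw [RootedForest.reattach_parent_of_ne h hb] at hab
        exact hT a b hab
    · exact Finset.sum_lt_sum (fun w _ => RootedForest.natDepth_le_reattach h hd w)
        ⟨v, Finset.mem_univ _, RootedForest.natDepth_lt_reattach_self h hd⟩
  refine ⟨T, fun a b hab => ?_, hT⟩
  rcases le_total (T.natDepth a) (T.natDepth b) with h | h
  · exact Or.inl (key b a hab.symm h)
  · exact Or.inr (key a b hab h)

/-- A finite graph without paths on `N` vertices has treedepth at most `N`. -/
theorem treedepth_le_of_no_path [Finite W] (N : ℕ)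
    (h : ∀ p : ℕ → W, (∀ i < N, ∀ j < N, p i = p j → i = j) →
      ¬ ∀ i, i + 1 < N → G.Adj (p i) (p (i + 1))) : G.treedepth ≤ N := by
  obtain ⟨T, hT, hadj⟩ := G.exists_isEliminationForest_parent_adj
  refine (iInf₂_le T hT).trans (iSup_le fun b => ?_)
  rw [← RootedForest.natDepth_eq_depth, Nat.cast_le]
  by_contra! hb
  obtain ⟨p, -, h1, h2⟩ := T.exists_parent_sequence N b hb.le
  refine h p (fun i hi j hj hij => ?_) fun i hi => hadj _ _ (h1 i hi)
  have h3 := h2 i hi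
  have h4 := h2 j hj
  rw [hij] at h3
  omega

/-- If any two equal values of a sequence have a smaller value between them and all values are at
least `m`, then some value on an interval of length `2 ^ c` is at least `m + c`. -/
theorem exists_add_le_of_smaller_between (f : ℕ → ℕ) (c a m : ℕ)
    (hm : ∀ i, a ≤ i → i < a + 2 ^ c → m ≤ f i)
    (hf : ∀ i j, a ≤ i → i < j → j < a + 2 ^ c → f i = f j → ∃ l, i < l ∧ l < j ∧ f l < f i) :
    ∃ i, a ≤ i ∧ i < a + 2 ^ c ∧ m + c ≤ f i := by
  induction c generalizing a m with
  | zero => exact ⟨a, le_rfl, by simp, hm a le_rfl (by simp)⟩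
  | succ c ih =>
    have h2 : 2 ^ (c + 1) = 2 ^ c + 2 ^ c := by ring
    rw [h2] at hm hf
    obtain ⟨a', ha, ha', hm'⟩ : ∃ a', a ≤ a' ∧ a' ≤ a + 2 ^ c ∧
        ∀ i, a' ≤ i → i < a' + 2 ^ c → m + 1 ≤ f i := by
      -- The value `m` cannot occur in both halves, as a value below `m` would lie between.
      by_cases hleft : ∀ i, a ≤ i → i < a + 2 ^ c → m + 1 ≤ f i
      · exact ⟨a, le_rfl, Nat.le_add_right _ _, hleft⟩
      · push Not at hleft
        obtain ⟨i, hi, hi', hfi⟩ := hleft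
        refine ⟨a + 2 ^ c, by omega, le_rfl, fun j hj hj' => ?_⟩
        by_contra! hfj
        have h3 := hm i hi (by omega)
        have h4 := hm j (by omega) (by omega)
        obtain ⟨l, hil, hlj, hl⟩ := hf i j hi (by omega) (by omega) (by omega)
        have h5 := hm l (by omega) (by omega)
        omega
    obtain ⟨i, hi, hi', hfi⟩ := ih a' (m + 1) hm' fun i j hi hij hj =>
      hf i j (by omega) hij (by omega)
    exact ⟨i, by omega, by omega, by omega⟩

/-- A graph with a path on `2 ^ c` vertices has treedepth more than `c`. -/
theorem lt_treedepth_of_path [Finite W] (c : ℕ) (p : ℕ → W)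
    (hp : ∀ i < 2 ^ c, ∀ j < 2 ^ c, p i = p j → i = j)
    (hadj : ∀ i, i + 1 < 2 ^ c → G.Adj (p i) (p (i + 1))) : (c + 1 : ℕ) ≤ G.treedepth := by
  refine le_iInf₂ fun T hT => ?_
  -- A shallowest vertex at the start of a stretch of the path is an ancestor of the whole stretch.
  have hdesc : ∀ i j, i ≤ j → j < 2 ^ c →
      (∀ l, i ≤ l → l ≤ j → T.natDepth (p i) ≤ T.natDepth (p l)) → T.IsAncestor (p i) (p j) := by
    intro i j hij
    induction j, hij using Nat.le_induction with
    | base => exact fun _ _ => Relation.ReflTransGen.refl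
    | succ j hij ih =>
      intro hj hl
      have h1 := ih (by omega) fun l h1 h2 => hl l h1 (by omega)
      rcases hT _ _ (hadj j hj) with h2 | h2
      · exact Relation.ReflTransGen.trans h1 h2
      · rcases RootedForest.IsAncestor.total h1 h2 with h3 | h3
        · exact h3
        · rw [h3.eq_of_natDepth_le (hl _ (by omega) le_rfl)]
          exact Relation.ReflTransGen.refl
  obtain ⟨i, -, hi, hle⟩ := exists_add_le_of_smaller_between (fun i => T.natDepth (p i)) c 0 1
    (fun i _ _ => T.one_le_natDepth _) (fun i j _ hij hj heq => by
      by_contra! hcon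
      have hanc := hdesc i j hij.le (by omega) fun l h1 h2 => by
        rcases Nat.eq_or_lt_of_le h1 with rfl | h1
        · exact le_rfl
        · rcases Nat.eq_or_lt_of_le h2 with rfl | h2
          · exact heq.le
          · exact hcon l h1 h2
      have := hp i (by omega) j (by omega) (hanc.eq_of_natDepth_le heq.ge)
      omega)
  refine le_trans ?_ (le_iSup _ (p i))
  rw [← RootedForest.natDepth_eq_depth, Nat.cast_le]
  omega

end SimpleGraph

/-! ### Fans and their subgraphs -/

namespace SimpleGraph

variable {V : Type u}

/-- A graph that embeds into a path is a linear forest. -/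
theorem isLinearForest_of_index [Finite V] {H : SimpleGraph V} (φ : V → ℕ)
    (hφ : Function.Injective φ) (hadj : ∀ w w', H.Adj w w' → φ w' = φ w + 1 ∨ φ w = φ w' + 1) :
    H.IsLinearForest := by
  intro C
  have hne : Nonempty C := C.nonempty_supp.to_subtype
  -- Discrete intermediate values: `φ` changes by one along edges, so a walk passes from `i` to `i +
  -- 1`.
  have hcross : ∀ (w w' : C) (i : ℕ), φ w ≤ i → i < φ w' →
      ∃ a b : C, C.toSimpleGraph.Adj a b ∧ φ a = i ∧ φ b = i + 1 := by
    intro w w' i hw hw'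
    obtain ⟨p⟩ := C.connected_toSimpleGraph.preconnected w w'
    obtain ⟨d, -, hd1, hd2⟩ := p.exists_boundary_dart {x | φ x ≤ i} hw (not_le.2 hw')
    have hd1 : φ d.fst ≤ i := hd1
    have hd2 : ¬ φ d.snd ≤ i := hd2
    have := hadj _ _ (show H.Adj d.fst d.snd from d.adj)
    exact ⟨d.fst, d.snd, d.adj, by omega, by omega⟩
  obtain ⟨a, ha⟩ := Finite.exists_min fun w : C => φ w
  obtain ⟨b, hb⟩ := Finite.exists_max fun w : C => φ w
  have hinj : ∀ w w' : C, φ w = φ w' → w = w' := fun w w' h => Subtype.ext (hφ h)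
  let f : C → Fin (φ b - φ a + 1) := fun w => ⟨φ w - φ a, by have := hb w; omega⟩
  have hf : Function.Bijective f := by
    constructor
    · intro w w' hww
      have h1 := ha w
      have h2 := ha w'
      have h3 : φ w - φ a = φ w' - φ a := congrArg Fin.val hww
      exact hinj w w' (by omega)
    · rintro ⟨k, hk⟩
      rcases k with _ | k
      · exact ⟨a, Fin.ext (by simp [f])⟩
      · obtain ⟨-, w, -, -, hw⟩ := hcross a b (φ a + k) (by omega) (by omega)
        exact ⟨w, Fin.ext (by simp only [f]; omega)⟩
  have hkey : ∀ w w' : C, φ w' = φ w + 1 → C.toSimpleGraph.Adj w w' := by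
    intro w w' h
    obtain ⟨x, y, hxy, hx, hy⟩ := hcross w w' (φ w) le_rfl (by omega)
    rwa [hinj x w hx, hinj y w' (hy.trans h.symm)] at hxy
  refine ⟨_, ⟨⟨Equiv.ofBijective f hf, ?_⟩⟩⟩
  intro w w'
  have h1 := ha w
  have h2 := ha w'
  rw [pathGraph_adj]
  simp only [Equiv.ofBijective_apply, f]
  constructor
  · rintro (h | h)
    · exact hkey w w' (by omega)
    · exact (hkey w' w (by omega)).symm
  · intro h
    have := hadj _ _ (show H.Adj w w' from h)
    omega

/-- The fan: a path on `N` vertices together with a vertex adjacent to all of them. -/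
def fanGraph (N : ℕ) : SimpleGraph (ULift.{v} (Option (Fin N))) where
  Adj a b := match a.down, b.down with
    | none, none => False
    | none, some _ => True
    | some _, none => True
    | some i, some j => (pathGraph N).Adj i j
  symm := ⟨by
    rintro ⟨_ | i⟩ ⟨_ | j⟩ h
    · exact h
    · trivial
    · trivial
    · exact Adj.symm h⟩
  loopless := ⟨by
    rintro ⟨_ | i⟩ h
    · exact h
    · exact (pathGraph N).irrefl h⟩

theorem ediam_fanGraph_le (N : ℕ) : (fanGraph.{v} N).ediam ≤ 3 := by
  refine ediam_le_of_edist_le fun a b => ?_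
  have h : ∀ a, (fanGraph.{v} N).edist a ⟨none⟩ ≤ 1 := by
    rintro ⟨_ | i⟩
    · simp
    · exact edist_le_one_iff_adj_or_eq.2 (Or.inl trivial)
  refine (SimpleGraph.edist_triangle (v := ⟨none⟩)).trans ?_
  refine (add_le_add (h a) (edist_comm.trans_le (h b))).trans ?_
  norm_num

theorem lt_treedepth_fanGraph (c : ℕ) : (c + 1 : ℕ) ≤ (fanGraph.{v} (2 ^ c)).treedepth := by
  refine lt_treedepth_of_path c (fun i => ⟨if h : i < 2 ^ c then some ⟨i, h⟩ else none⟩) ?_ ?_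
  · intro i hi j hj hij
    simpa [hi, hj] using hij
  · intro i hi
    have hi' : i < 2 ^ c := by omega
    simp only [fanGraph, hi, hi', dite_true, pathGraph_adj]
    exact Or.inl trivial

/-- The subgraphs of fans are apex linear forests. -/
theorem isApexLinearForest_of_isContained_fanGraph [Finite V] [Nonempty V] {F : SimpleGraph V}
    {N : ℕ} (h : F ⊑ fanGraph.{v} N) : F.IsApexLinearForest := by
  obtain ⟨f⟩ := h
  have hx : ∃ x : V, ∀ w, w ≠ x → (f w).down ≠ none := by
    by_cases hx : ∃ x, (f x).down = none
    · obtain ⟨x, hx⟩ := hx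
      exact ⟨x, fun w hw hwn => hw (f.injective (ULift.down_injective (hwn.trans hx.symm)))⟩
    -- If the hub is not used, any vertex may be deleted.
    · exact ⟨Classical.arbitrary V, fun w _ hwn => hx ⟨w, hwn⟩⟩
  obtain ⟨x, hx⟩ := hx
  have hx' : ∀ w : ({x}ᶜ : Set V), ∃ i : Fin N, f w = ⟨some i⟩ := by
    intro w
    obtain ⟨i, hi⟩ := Option.ne_none_iff_exists'.1 (hx w w.2)
    exact ⟨i, ULift.down_injective hi⟩
  choose φ hφ using hx'
  refine ⟨x, isLinearForest_of_index (fun w => φ w) ?_ ?_⟩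
  · intro w w' h
    refine Subtype.ext (f.injective ?_)
    change f w = f w'
    rw [hφ, hφ, Fin.ext h]
  · intro w w' h
    have h1 : (fanGraph.{v} N).Adj (f w) (f w') := f.toHom.map_adj h
    rw [hφ, hφ] at h1
    have h2 : (pathGraph N).Adj (φ w) (φ w') := h1
    rw [pathGraph_adj] at h2
    omega

end SimpleGraph

theorem mainTheorem3 {V : Type u} [Finite V] (F : SimpleGraph V) (hF : F.IsTree) :
    SimpleGraph.HasBoundedTreedepth.{v} (fun _ G => F.Free G ∧ G.ediam ≤ 3) ↔
      F.IsAcyclic ∧ F.IsApexLinearForest := by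
  constructor
  · rintro ⟨c, hc⟩
    refine ⟨hF.isAcyclic, ?_⟩
    have := hF.connected.nonempty
    by_contra hA
    have h1 := hc _ (SimpleGraph.fanGraph.{v} (2 ^ c))
      ⟨fun h => hA (SimpleGraph.isApexLinearForest_of_isContained_fanGraph h),
        SimpleGraph.ediam_fanGraph_le _⟩
    have h2 : c + 1 ≤ c := by
      exact_mod_cast (SimpleGraph.lt_treedepth_fanGraph.{v} c).trans h1
    omega
  · rintro ⟨hacyc, hA⟩
    obtain ⟨N, hN⟩ := SimpleGraph.exists_path_bound_of_hasSpoilers.{v} (Nat.card V)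
      (Nat.card V * (2 * Nat.card V + 2) + 1)
    refine ⟨N, fun W _ G hG => SimpleGraph.treedepth_le_of_no_path N ?_⟩
    exact hN W G (hacyc.hasSpoilers_of_free hA hG.1) (SimpleGraph.ediam_le_iff.1 hG.2)
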